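/- Let $K$ be an algebraically closed field and let $Q$ be a finite connected quiver. Paths in $Q$ are composed from left to right, so for arrows $\alpha:i\to j$ and $\beta:j\to k$ the path $\alpha\beta$ goes from $i$ to $k$. Let $R$ be the ideal of the path algebra $KQ$ generated by the arrows, and let $I$ be an admissible ideal of $KQ$, that is, a two-sided ideal with $R^m\subseteq I\subseteq R^2$ for some $m\geq 2$. Put $\Lambda=KQ/I$. Assume that (a) $\Lambda$ is symmetric, that is, there is a nondegenerate symmetric $K$-bilinear form $(-,-):\Lambda\times\Lambda\to K$ with $(ab,c)=(a,bc)$ for all $a,b,c\in\Lambda$; and (b) $\Lambda$ is a periodic algebra of period $4$, that is, $d=4$ is the smallest integer $d\geq 1$ such that $\Omega^d(\Lambda)\cong\Lambda$ as $\Lambda$-bimodules, where $\Omega$ denotes the syzygy (the kernel of a projective cover) of modules over the enveloping algebra $\Lambda\otimes_K\Lambda^{\mathrm{op}}$. A minimal relation of $I$ is an element of $I$ that does not lie in $RI+IR$. For a path $p$ in $Q$ write $p\prec I$ if $p$ occurs with nonzero coefficient in some minimal relation of $I$. Let $\alpha:i\to j$ and $\beta:j\to k$ be arrows of $Q$ with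 $\alpha\beta\prec I$. Then $Q$ has an arrow $k\to i$, so that $\alpha$ and $\beta$ are part of a triangle $i\to j\to k\to i$ in $Q$ (where the vertices $i,j,k$ need not be distinct). No assumption on the representation type of $\Lambda$ (tame or wild), and no bound on the number of arrows starting or ending at a vertex of $Q$, is needed. -/

import Mathlib

open scoped TensorProduct

universe u v w

noncomputable section

/-- All paths of a quiver, including the trivial path `e_a` at each vertex `a`. -/
abbrev QuiverPath (V : Type v) [Quiver.{w} V] : Type (max v w) :=
  Σ a b : V, Quiver.Path a b

/-- The path algebra `K Q`: formal linear combinations of paths. Paths are composed from left to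
right, so that for arrows `α : i ⟶ j` and `β : j ⟶ k` the product `α β` is the path
"first `α`, then `β`". -/
def PathAlgebra (K : Type u) (V : Type v) [Field K] [Quiver.{w} V] : Type (max u v w) :=
  QuiverPath V →₀ K

namespace PathAlgebra

section Basic

variable (K : Type u) {V : Type v} [Field K] [Quiver.{w} V]

instance : AddCommGroup (PathAlgebra K V) := inferInstanceAs (AddCommGroup (QuiverPath V →₀ K))

instance : Module K (PathAlgebra K V) := inferInstanceAs (Module K (QuiverPath V →₀ K))

/-- A path, as an element of the path algebra. -/
def ofPath {a b : V} (p : Quiver.Path a b) : PathAlgebra K V :=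
  Finsupp.single (⟨a, b, p⟩ : QuiverPath V) (1 : K)

/-- The coefficient of a path in an element of the path algebra. -/
def coeff {K : Type u} [Field K] (x : PathAlgebra K V) {a b : V} (p : Quiver.Path a b) : K :=
  (show QuiverPath V →₀ K from x) ⟨a, b, p⟩

open Classical in
/-- The product of two paths: their composition if the first ends where the second starts, and
zero otherwise. -/
def pathMul (p q : QuiverPath V) : PathAlgebra K V :=
  if h : p.2.1 = q.1 then ofPath K (p.2.2.comp (q.2.2.cast h.symm rfl)) else 0

/-- The multiplication of the path algebra, as the bilinear extension of `pathMul`. -/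
def mulHom : PathAlgebra K V →ₗ[K] PathAlgebra K V →ₗ[K] PathAlgebra K V :=
  Finsupp.linearCombination K fun p : QuiverPath V =>
    (Finsupp.linearCombination K fun q : QuiverPath V => pathMul K p q :
      (QuiverPath V →₀ K) →ₗ[K] PathAlgebra K V)

instance : Mul (PathAlgebra K V) := ⟨fun x y => mulHom K x y⟩

theorem mulHom_ofPath {a b c d : V} (p : Quiver.Path a b) (q : Quiver.Path c d) :
    mulHom K (ofPath K p) (ofPath K q) = pathMul K ⟨a, b, p⟩ ⟨c, d, q⟩ := by
  unfold mulHom ofPath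
  erw [Finsupp.linearCombination_single, one_smul, Finsupp.linearCombination_single, one_smul]

theorem pathMul_comp {a b c : V} (p : Quiver.Path a b) (q : Quiver.Path b c) :
    pathMul K ⟨a, b, p⟩ ⟨b, c, q⟩ = ofPath K (p.comp q) := by
  simp [pathMul]

theorem pathMul_of_ne {a b c d : V} (p : Quiver.Path a b) (q : Quiver.Path c d) (h : b ≠ c) :
    pathMul K ⟨a, b, p⟩ ⟨c, d, q⟩ = 0 := by
  simp [pathMul, h]

variable {K} in
/-- Induction on elements of the path algebra: they are sums of scalar multiples of paths. -/
theorem induction_on {P : PathAlgebra K V → Prop} (x : PathAlgebra K V) (zero : P 0)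
    (add : ∀ y z, P y → P z → P (y + z))
    (smul_path : ∀ (c : K) (a b : V) (p : Quiver.Path a b), P (c • ofPath K p)) : P x := by
  refine Finsupp.induction_linear (motive := P) x zero add ?_
  rintro ⟨a, b, p⟩ c
  have h := smul_path c a b p
  have e : c • ofPath K p = (Finsupp.single (⟨a, b, p⟩ : QuiverPath V) c : PathAlgebra K V) := by
    unfold ofPath
    erw [Finsupp.smul_single, smul_eq_mul, mul_one]
  rwa [e] at h

theorem mulHom_assoc (x y z : PathAlgebra K V) :
    mulHom K (mulHom K x y) z = mulHom K x (mulHom K y z) := by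
  induction x using induction_on with
  | zero => simp
  | add x₁ x₂ h₁ h₂ => simp [h₁, h₂]
  | smul_path r a b p =>
    induction y using induction_on with
    | zero => simp
    | add y₁ y₂ h₁ h₂ => simp only [map_add, LinearMap.add_apply, h₁, h₂]
    | smul_path s c d q =>
      induction z using induction_on with
      | zero => simp
      | add z₁ z₂ h₁ h₂ => simp only [map_add, h₁, h₂]
      | smul_path t e f l =>
        simp only [map_smul, LinearMap.smul_apply, mulHom_ofPath]
        congr 3
        by_cases hbc : b = c
        · subst hbc
          by_cases hde : d = e
          · subst hde
            simp [pathMul_comp, mulHom_ofPath, Quiver.Path.comp_assoc]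
          · simp [pathMul_comp, mulHom_ofPath, pathMul_of_ne _ _ _ hde]
        · by_cases hde : d = e
          · subst hde
            simp [pathMul_comp, mulHom_ofPath, pathMul_of_ne _ _ _ hbc]
          · simp [pathMul_of_ne _ _ _ hbc, pathMul_of_ne _ _ _ hde]

end Basic

section Algebra

variable (K : Type u) {V : Type v} [Field K] [Quiver.{w} V] [Fintype V]

/-- The unit of the path algebra of a quiver with finitely many vertices is the sum of all
trivial paths. -/
instance : One (PathAlgebra K V) := ⟨∑ a : V, ofPath K (Quiver.Path.nil : Quiver.Path a a)⟩

theorem mulHom_one_left (x : PathAlgebra K V) : mulHom K 1 x = x := by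
  change mulHom K (∑ a : V, ofPath K (Quiver.Path.nil : Quiver.Path a a)) x = x
  induction x using induction_on with
  | zero => simp
  | add x₁ x₂ h₁ h₂ => simp only [map_add, h₁, h₂]
  | smul_path r a b p =>
    simp only [map_smul, map_sum, LinearMap.sum_apply, mulHom_ofPath]
    rw [Finset.sum_eq_single a, pathMul_comp, Quiver.Path.nil_comp]
    · exact fun c _ hc => pathMul_of_ne K _ _ hc
    · simp

theorem mulHom_one_right (x : PathAlgebra K V) : mulHom K x 1 = x := by
  change mulHom K x (∑ a : V, ofPath K (Quiver.Path.nil : Quiver.Path a a)) = x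
  induction x using induction_on with
  | zero => simp
  | add x₁ x₂ h₁ h₂ => simp only [map_add, LinearMap.add_apply, h₁, h₂]
  | smul_path r a b p =>
    rw [map_smul, LinearMap.smul_apply, map_sum]
    simp only [mulHom_ofPath]
    rw [Finset.sum_eq_single b, pathMul_comp, Quiver.Path.comp_nil]
    · exact fun c _ hc => pathMul_of_ne K _ _ hc.symm
    · simp

instance : Ring (PathAlgebra K V) :=
  { (inferInstance : AddCommGroup (PathAlgebra K V)),
    (inferInstance : Mul (PathAlgebra K V)),
    (inferInstance : One (PathAlgebra K V)) with
    left_distrib := fun x y z => map_add (mulHom K x) y z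
    right_distrib := fun x y z => LinearMap.map_add₂ (mulHom K) x y z
    zero_mul := fun x => LinearMap.map_zero₂ (mulHom K) x
    mul_zero := fun x => map_zero (mulHom K x)
    mul_assoc := mulHom_assoc K
    one_mul := mulHom_one_left K
    mul_one := mulHom_one_right K }

instance : Algebra K (PathAlgebra K V) :=
  Algebra.ofModule (fun r x y => LinearMap.map_smul₂ (mulHom K) r x y)
    (fun r x y => map_smul (mulHom K x) r y)

variable (V) in
/-- The arrow ideal of the path algebra: the two-sided ideal generated by all arrows. -/
def arrowIdeal : Ideal (PathAlgebra K V) :=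
  (TwoSidedIdeal.span
    {x : PathAlgebra K V | ∃ (a b : V) (α : a ⟶ b), x = ofPath K α.toPath}).asIdeal

variable {K}

/-- A two-sided ideal `I` of `K Q` is admissible if `R ^ m ⊆ I ⊆ R ^ 2` for some `m ≥ 2`, where
`R` is the arrow ideal. -/
def IsAdmissible (I : Ideal (PathAlgebra K V)) : Prop :=
  I.IsTwoSided ∧ I ≤ arrowIdeal K V ^ 2 ∧ ∃ m : ℕ, 2 ≤ m ∧ arrowIdeal K V ^ m ≤ I

/-- A minimal relation of `I`, i.e. a minimal generator of the two-sided ideal `I`: an element of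
`I` whose class in `I / (R I + I R)` is nonzero, where `R` is the arrow ideal. -/
def IsMinimalRelation (I : Ideal (PathAlgebra K V)) (ρ : PathAlgebra K V) : Prop :=
  ρ ∈ I ∧ ρ ∉ arrowIdeal K V * I ⊔ I * arrowIdeal K V

/-- The relation `p ≺ I`: the path `p` occurs, with nonzero coefficient, as a term of some
minimal relation of `I`. -/
def OccursInMinimalRelation (I : Ideal (PathAlgebra K V)) {a b : V} (p : Quiver.Path a b) :
    Prop :=
  ∃ ρ : PathAlgebra K V, IsMinimalRelation I ρ ∧ ρ.coeff p ≠ 0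

end Algebra

end PathAlgebra

/-- A quiver is connected if it is nonempty and its underlying undirected graph is connected. -/
def IsConnectedQuiver (V : Type v) [Quiver.{w} V] : Prop :=
  Nonempty V ∧ Subsingleton (Quiver.WeaklyConnectedComponent V)

/-- A `K`-algebra is symmetric if it carries a nondegenerate symmetric bilinear form which is
associative. -/
def IsSymmetricFDAlgebra (K : Type u) (A : Type v) [Field K] [Ring A] [Algebra K A] : Prop :=
  ∃ B : LinearMap.BilinForm K A, B.Nondegenerate ∧ (∀ a b : A, B a b = B b a) ∧
    ∀ a b c : A, B (a * b) c = B a (b * c)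

section Syzygy

variable (R : Type u) [Ring R]

/-- A submodule `N` of `P` is superfluous if `N + L = P` forces `L = P`. -/
def IsSuperfluous {P : Type v} [AddCommGroup P] [Module R P] (N : Submodule R P) : Prop :=
  ∀ L : Submodule R P, N ⊔ L = ⊤ → L = ⊤

/-- A projective cover of `M`: a surjection from a projective module with superfluous kernel. -/
def IsProjectiveCover {P M : Type v} [AddCommGroup P] [Module R P] [AddCommGroup M] [Module R M]
    (π : P →ₗ[R] M) : Prop :=
  Module.Projective R P ∧ Function.Surjective π ∧ IsSuperfluous R (LinearMap.ker π)

/-- `N` is isomorphic to the syzygy `Ω M`, the kernel of a projective cover of `M`. -/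
def IsSyzygy (M N : Type v) [AddCommGroup M] [Module R M] [AddCommGroup N] [Module R N] : Prop :=
  ∃ (P : Type v) (_ : AddCommGroup P) (_ : Module R P) (π : P →ₗ[R] M),
    IsProjectiveCover R π ∧ Nonempty (N ≃ₗ[R] LinearMap.ker π)

/-- `N` is isomorphic to the `n`-th syzygy `Ω ^ n M`. -/
def IsIteratedSyzygy : ℕ → ∀ (M N : Type v) [AddCommGroup M] [Module R M] [AddCommGroup N]
    [Module R N], Prop
  | 0, M, N, _, _, _, _ => Nonempty (M ≃ₗ[R] N)
  | n + 1, M, N, _, _, _, _ => ∃ (L : Type v) (_ : AddCommGroup L) (_ : Module R L),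
      IsSyzygy R M L ∧ IsIteratedSyzygy n L N

/-- `M` is a periodic module of period `d`: `d` is the smallest positive integer such that
`Ω ^ d M` is isomorphic to `M`. -/
def HasPeriod (M : Type v) [AddCommGroup M] [Module R M] (d : ℕ) : Prop :=
  1 ≤ d ∧ IsIteratedSyzygy R d M M ∧ ∀ e : ℕ, 1 ≤ e → e < d → ¬ IsIteratedSyzygy R e M M

end Syzygy

/-- `A` is a periodic algebra of period `d`: it has period `d` as a bimodule over itself, i.e. as
a module over its enveloping algebra, where `a ⊗ b` acts by `x ↦ a * x * b`. -/
def IsPeriodicAlgebra (K : Type u) (A : Type v) [Field K] [Ring A] [Algebra K A] (d : ℕ) : Prop :=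
  letI : Module (A ⊗[K] Aᵐᵒᵖ) A := TensorProduct.Algebra.module
  HasPeriod (A ⊗[K] Aᵐᵒᵖ) A d

end

/-!
Let `S_l` be the simple module at the vertex `l`. The bimodule syzygies of `Λ = K Q / I` are
projective as right modules, so tensoring the bimodule resolution of `Λ` with `S_k` gives
`Ω⁴ S_k ≅ S_k` up to projective summands. A relation in which a path of length two from `i` to `k`
occurs defines a nonzero class in `Ext²(S_k, S_i)`, visible on the second syzygy through the term
`J / I J` of Gruenberg's resolution of `S_k`. Over the symmetric algebra `Λ` the stable maps
`Ω² S_k → S_i` are dual to `Ext¹(S_i, Ω⁴ S_k) = Ext¹(S_i, S_k)`, which therefore does not vanish;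
this is to say that there is an arrow from `k` to `i`.
-/

open MulOpposite

universe x

noncomputable section

section Character

variable {K A : Type*} [Field K] [Ring A] [Algebra K A]

/-- The one-dimensional left module on which `A` acts through the character `χ`. -/
def OneDim (_χ : A →ₐ[K] K) : Type _ := K

namespace OneDim

variable (χ : A →ₐ[K] K)

instance : AddCommGroup (OneDim χ) := inferInstanceAs (AddCommGroup K)

instance : Module K (OneDim χ) := inferInstanceAs (Module K K)

instance : Module A (OneDim χ) := Module.compHom K (χ : A →+* K)

variable {χ}

theorem smul_eq (a : A) (x : OneDim χ) : a • x = χ a • x := rfl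

instance : IsScalarTower K A (OneDim χ) := ⟨fun c a x => by
  simp only [smul_eq, map_smul, smul_assoc]⟩

variable (χ) in
/-- The augmentation `a ↦ χ a` of the regular module. -/
def proj : A →ₗ[A] OneDim χ where
  toFun a := χ a
  map_add' := map_add χ
  map_smul' := map_mul χ

theorem proj_surjective : Function.Surjective (proj χ) := fun c =>
  ⟨algebraMap K A c, χ.commutes c⟩

end OneDim

/-- `s` spans the part of the left socle of `A` on which `A` acts through the character `χ`, and `A`
acts on `s` through `χ` from the right as well. -/
structure IsSocleGenerator (χ : A →ₐ[K] K) (s : A) : Prop where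
  ne_zero : s ≠ 0
  mul_left : ∀ u, u * s = χ u • s
  mul_right : ∀ u, s * u = χ u • s
  exists_eq_smul : ∀ a, (∀ u, χ u = 0 → u * a = 0) → ∃ c : K, a = c • s

theorem smul_eq_character_smul {χ : A →ₐ[K] K} {M : Type*} [AddCommGroup M] [Module K M]
    [Module A M] [IsScalarTower K A M] {y : M} (hy : ∀ u, χ u = 0 → u • y = 0) (u : A) :
    u • y = χ u • y := by
  have h := hy (u - algebraMap K A (χ u)) (by simp)
  rwa [sub_smul, algebraMap_smul, sub_eq_zero] at h

theorem IsSymmetricFDAlgebra.exists_isSocleGenerator [FiniteDimensional K A]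
    (h : IsSymmetricFDAlgebra K A) (χ : A →ₐ[K] K) : ∃ s, IsSocleGenerator χ s := by
  obtain ⟨B, hB, hsymm, hassoc⟩ := h
  let s : A := (B.toDual hB).symm χ.toLinearMap
  have hs (v : A) : B s v = χ v :=
    LinearMap.BilinForm.apply_toDual_symm_apply χ.toLinearMap v
  have ext {a b : A} (hab : ∀ v, B a v = B b v) : a = b :=
    (B.toDual hB).injective (LinearMap.ext hab)
  refine ⟨s, fun h0 => ?_, fun u => ext fun v => ?_, fun u => ext fun v => ?_, fun a ha =>
    ⟨B 1 a, ext fun v => ?_⟩⟩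
  · simpa [h0] using hs 1
  · rw [hsymm, ← hassoc, hsymm, hs, map_mul, map_smul, LinearMap.smul_apply, hs, smul_eq_mul,
      mul_comm]
  · rw [hassoc, hs, map_mul, map_smul, LinearMap.smul_apply, hs, smul_eq_mul]
  · rw [hsymm, ← one_mul v, hassoc, one_mul, ← smul_eq_mul, smul_eq_character_smul ha, map_smul,
      map_smul, LinearMap.smul_apply, hs, smul_eq_mul, smul_eq_mul, mul_comm]

namespace IsSocleGenerator

variable {χ : A →ₐ[K] K} {s : A} {P : Type*} [AddCommGroup P] [Module A P]
  [Module.Projective A P]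

theorem apply_eq_zero_of_smul_eq_zero (hs : IsSocleGenerator χ s) (Θ : P →ₗ[A] OneDim χ) {p : P}
    (hp : s • p = 0) : Θ p = 0 := by
  obtain ⟨Φ, hΦ⟩ := Module.projective_lifting_property (OneDim.proj χ) Θ OneDim.proj_surjective
  have h : χ (Φ p) • s = 0 := by
    rw [← hs.mul_right, ← smul_eq_mul, ← map_smul, hp, map_zero]
  rw [← hΦ]
  exact (smul_eq_zero.1 h).resolve_right hs.ne_zero

theorem exists_eq_smul_of_projective (hs : IsSocleGenerator χ s) {y : P}
    (hy : ∀ u, χ u = 0 → u • y = 0) : ∃ w : P, y = s • w := by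
  obtain ⟨f, hf⟩ := Module.projective_def'.1 ‹Module.Projective A P›
  have hcoeff (x : P) : ∃ c : K, f y x = c • s := hs.exists_eq_smul _ fun u hu => by
    rw [← smul_eq_mul, ← Finsupp.smul_apply, ← map_smul, hy u hu, map_zero, Finsupp.zero_apply]
  choose c hc using hcoeff
  refine ⟨∑ x ∈ (f y).support, algebraMap K A (c x) • x, ?_⟩
  calc y = (f y).sum fun x a => a • x := (LinearMap.congr_fun hf y).symm
    _ = _ := by
      rw [Finset.smul_sum]
      refine Finset.sum_congr rfl fun x _ => ?_
      rw [smul_smul, ← Algebra.commutes, ← Algebra.smul_def, ← hc]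

end IsSocleGenerator

end Character

section StableSyzygy

/-- `N` is a syzygy of `M` up to projective direct summands: there is a short exact sequence
`0 → N → P → M → 0` with `P` projective. -/
def IsStableSyzygy (R : Type u) [Ring R] (M N : Type v) [AddCommGroup M] [Module R M]
    [AddCommGroup N] [Module R N] : Prop :=
  ∃ (P : Type v) (_ : AddCommGroup P) (_ : Module R P) (j : N →ₗ[R] P) (π : P →ₗ[R] M),
    Module.Projective R P ∧ Function.Injective j ∧ Function.Exact j π ∧ Function.Surjective π

theorem IsSyzygy.isStableSyzygy {R : Type u} [Ring R] {M N : Type v} [AddCommGroup M] [Module R M]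
    [AddCommGroup N] [Module R N] (h : IsSyzygy R M N) : IsStableSyzygy R M N := by
  obtain ⟨P, _, _, π, ⟨hP, hπ, -⟩, ⟨e⟩⟩ := h
  refine ⟨P, _, _, (LinearMap.ker π).subtype ∘ₗ e.toLinearMap, π, hP,
    Subtype.val_injective.comp e.injective, LinearMap.exact_iff.2 ?_, hπ⟩
  simp [LinearMap.range_comp]

theorem IsStableSyzygy.congr_right {R : Type u} [Ring R] {M N N' : Type v} [AddCommGroup M]
    [Module R M] [AddCommGroup N] [Module R N] [AddCommGroup N'] [Module R N']
    (h : IsStableSyzygy R M N) (e : N' ≃ₗ[R] N) : IsStableSyzygy R M N' := by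
  obtain ⟨P, _, _, j, π, hP, hj, hjπ, hπ⟩ := h
  refine ⟨P, _, _, j ∘ₗ e.toLinearMap, π, hP, hj.comp e.injective, LinearMap.exact_iff.2 ?_, hπ⟩
  rw [LinearMap.range_comp, LinearEquiv.range, Submodule.map_top, hjπ.linearMap_ker_eq]

/-- Every extension of `OneDim χ` by `S` splits: the `A`-linear maps from the kernel of `χ` to `S`
are the restrictions of those from `A`. -/
def ExtVanishes {K A : Type*} [Field K] [Ring A] [Algebra K A] (χ : A →ₐ[K] K) (S : Type*)
    [AddCommGroup S] [Module A S] : Prop :=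
  ∀ φ : RingHom.ker χ →ₗ[A] S, ∃ x : S, ∀ u, φ u = (u : A) • x

theorem ExtVanishes.congr {K A : Type*} [Field K] [Ring A] [Algebra K A] {χ : A →ₐ[K] K}
    {S S' : Type*} [AddCommGroup S] [Module A S] [AddCommGroup S'] [Module A S']
    (h : ExtVanishes χ S) (e : S' ≃ₗ[A] S) : ExtVanishes χ S' := by
  intro φ
  obtain ⟨x, hx⟩ := h (e.toLinearMap ∘ₗ φ)
  exact ⟨e.symm x, fun u => by rw [← map_smul, ← hx]; exact (e.symm_apply_apply _).symm⟩

theorem ExtVanishes.exists_forall_smul_sub_eq_zero {K A : Type*} [Field K] [Ring A] [Algebra K A]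
    {χ : A →ₐ[K] K} {S P : Type*} [AddCommGroup S] [Module A S] [AddCommGroup P] [Module A P]
    (hS : ExtVanishes χ S) {ι : S →ₗ[A] P} (hι : Function.Injective ι) {y : P}
    (hy : ∀ u, χ u = 0 → u • y ∈ LinearMap.range ι) :
    ∃ x, ∀ u, χ u = 0 → u • (y - ι x) = 0 := by
  let φ : RingHom.ker χ →ₗ[A] S := (LinearEquiv.ofInjective ι hι).symm.toLinearMap ∘ₗ
    (LinearMap.toSpanSingleton A P y ∘ₗ (RingHom.ker χ).subtype).codRestrict (LinearMap.range ι)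
      fun u => hy u u.2
  obtain ⟨x, hx⟩ := hS φ
  refine ⟨x, fun u hu => ?_⟩
  have hφ : ι (φ ⟨u, hu⟩) = u • y :=
    congrArg Subtype.val ((LinearEquiv.ofInjective ι hι).apply_symm_apply _)
  rw [smul_sub, ← hφ, hx, map_smul, sub_self]

/-- Half of the duality between the stable maps `L → OneDim χ` and `Ext¹(OneDim χ, Ω² L)`. -/
theorem IsSocleGenerator.apply_eq_zero_of_isStableSyzygy {K : Type*} {A : Type u} [Field K]
    [Ring A] [Algebra K A] {χ : A →ₐ[K] K} {s : A} (hs : IsSocleGenerator χ s)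
    {L N S : Type v} [AddCommGroup L] [Module A L] [AddCommGroup N] [Module A N] [AddCommGroup S]
    [Module A S] (hLN : IsStableSyzygy A L N) (hNS : IsStableSyzygy A N S) (hS : ExtVanishes χ S)
    (Θ : L →ₗ[A] OneDim χ) {z : L} (hz : s • z = 0) : Θ z = 0 := by
  obtain ⟨P, _, _, j, π, _, hj, hjπ, hπ⟩ := hLN
  obtain ⟨Q, _, _, ι, σ, _, hι, hισ, hσ⟩ := hNS
  obtain ⟨p, rfl⟩ := hπ z
  obtain ⟨l, hl⟩ := (hjπ (s • p)).1 (by rw [map_smul, hz])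
  obtain ⟨y, rfl⟩ := hσ l
  have hker (u : A) (hu : χ u = 0) : u • y ∈ LinearMap.range ι := by
    refine (hισ _).1 (hj ?_)
    have hus : u * s = 0 := by rw [hs.mul_left, hu, zero_smul]
    rw [map_smul, map_smul, hl, smul_smul, hus, zero_smul, map_zero]
  obtain ⟨x, hx⟩ := hS.exists_forall_smul_sub_eq_zero hι hker
  obtain ⟨w, hw⟩ := hs.exists_eq_smul_of_projective hx
  have hp : s • (p - j (σ w)) = 0 := by
    have hσy : σ y = s • σ w := by
      rw [← map_smul, ← hw, map_sub, hισ.apply_apply_eq_zero, sub_zero]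
    rw [smul_sub, ← hl, hσy, map_smul, sub_self]
  simpa [hjπ.apply_apply_eq_zero] using hs.apply_eq_zero_of_smul_eq_zero (Θ ∘ₗ π) hp

end StableSyzygy

section Restrict

/-- The `S`-module `M` with its scalars restricted along `φ : R →+* S`. -/
def Restrict {R S : Type*} [Ring R] [Ring S] (_φ : R →+* S) (M : Type*) : Type _ := M

namespace Restrict

variable {R S M N : Type*} [Ring R] [Ring S] (φ : R →+* S) [AddCommGroup M] [AddCommGroup N]
  [Module S M] [Module S N]

instance : AddCommGroup (Restrict φ M) := inferInstanceAs (AddCommGroup M)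

instance : Module R (Restrict φ M) := Module.compHom M φ

/-- The identity of `M`, with values in the restriction. -/
def of : M ≃+ Restrict φ M := AddEquiv.refl M

theorem smul_of (r : R) (x : M) : r • of φ x = of φ (φ r • x) := rfl

/-- An `S`-linear map, viewed as a linear map for the restricted scalars. -/
def map (f : M →ₗ[S] N) : Restrict φ M →ₗ[R] Restrict φ N where
  toFun x := of φ (f ((of φ).symm x))
  map_add' := f.map_add
  map_smul' r := f.map_smul (φ r)

@[simp]
theorem map_of (f : M →ₗ[S] N) (x : M) : map φ f (of φ x) = of φ (f x) := rfl

theorem projective [Module.Projective R (Restrict φ S)] [Module.Projective S M] :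
    Module.Projective R (Restrict φ M) := by
  classical
  obtain ⟨f, hf⟩ := Module.projective_def'.1 ‹Module.Projective S M›
  have hfree : Module.Projective R (Restrict φ (M →₀ S)) :=
    Module.Projective.of_equiv' (M := Π₀ _ : M, Restrict φ S) (finsuppLequivDFinsupp R).symm
  exact Module.Projective.of_split (map φ f) (map φ (Finsupp.linearCombination S id))
    (LinearMap.ext fun x => LinearMap.congr_fun hf x)

end Restrict

theorem exists_retraction {R M N P : Type*} [Ring R] [AddCommGroup M] [Module R M]
    [AddCommGroup N] [Module R N] [AddCommGroup P] [Module R P] [Module.Projective R M]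
    {j : N →ₗ[R] P} {π : P →ₗ[R] M} (hj : Function.Injective j) (hjπ : Function.Exact j π)
    (hπ : Function.Surjective π) : ∃ r : P →ₗ[R] N, r ∘ₗ j = LinearMap.id :=
  ((hjπ.split_tfae'.out 0 1 :).1 ⟨hj, Module.projective_lifting_property π LinearMap.id hπ⟩).2

end Restrict

section Enveloping

/-- The enveloping algebra of `A`, whose modules are the `A`-bimodules. -/
abbrev Enveloping (K A : Type*) [Field K] [Ring A] [Algebra K A] : Type _ := A ⊗[K] Aᵐᵒᵖ

variable {K A : Type*} [Field K] [Ring A] [Algebra K A]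

variable (K A) in
/-- The underlying left module of a bimodule. -/
abbrev LeftModule (X : Type*) : Type _ :=
  Restrict (Algebra.TensorProduct.includeLeftRingHom : A →+* Enveloping K A) X

variable (K A) in
/-- The underlying right module of a bimodule. -/
abbrev RightModule (X : Type*) : Type _ :=
  Restrict (Algebra.TensorProduct.includeRight : Aᵐᵒᵖ →ₐ[K] Enveloping K A).toRingHom X

instance : Module.Projective Aᵐᵒᵖ (RightModule K A (Enveloping K A)) :=
  Module.Projective.of_equiv' (M := Aᵐᵒᵖ ⊗[K] A)
    { (TensorProduct.comm K Aᵐᵒᵖ A).toAddEquiv with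
      map_smul' := fun b x => by
        change TensorProduct.comm K Aᵐᵒᵖ A (b • x) =
          (1 ⊗ₜ[K] b : Enveloping K A) * TensorProduct.comm K Aᵐᵒᵖ A x
        induction x with
        | zero => simp
        | add x y hx hy => rw [smul_add, map_add, hx, hy, map_add, mul_add]
        | tmul c a => simp [TensorProduct.smul_tmul'] }

theorem exists_rightModule_retraction {M N P : Type*} [AddCommGroup M] [AddCommGroup N]
    [AddCommGroup P] [Module (Enveloping K A) M] [Module (Enveloping K A) N]
    [Module (Enveloping K A) P] [Module.Projective Aᵐᵒᵖ (RightModule K A M)]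
    {j : N →ₗ[Enveloping K A] P} {π : P →ₗ[Enveloping K A] M} (hj : Function.Injective j)
    (hjπ : Function.Exact j π) (hπ : Function.Surjective π) :
    ∃ r : RightModule K A P →ₗ[Aᵐᵒᵖ] RightModule K A N, r ∘ₗ Restrict.map _ j = LinearMap.id :=
  exists_retraction (π := Restrict.map _ π) hj hjπ hπ

theorem IsStableSyzygy.projective_rightModule {M N : Type v} [AddCommGroup M] [AddCommGroup N]
    [Module (Enveloping K A) M] [Module (Enveloping K A) N]
    [Module.Projective Aᵐᵒᵖ (RightModule K A M)] (h : IsStableSyzygy (Enveloping K A) M N) :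
    Module.Projective Aᵐᵒᵖ (RightModule K A N) := by
  obtain ⟨P, _, _, j, π, _, hj, hjπ, hπ⟩ := h
  have hP : Module.Projective Aᵐᵒᵖ (RightModule K A P) := Restrict.projective _
  obtain ⟨r, hr⟩ := exists_rightModule_retraction hj hjπ hπ
  exact Module.Projective.of_split _ r hr

/-- The homomorphism `a ⊗ b ↦ χ b • a` defined by a character `χ`. -/
def rightCharacter (χ : A →ₐ[K] K) : Enveloping K A →ₐ[K] A :=
  Algebra.TensorProduct.lift (AlgHom.id K A)
    ((Algebra.ofId K A).comp (χ.fromOpposite fun _ _ => Commute.all _ _))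
    fun a _ => (Algebra.commute_algebraMap_left _ a).symm

theorem rightCharacter_tmul (χ : A →ₐ[K] K) (a : A) (b : Aᵐᵒᵖ) :
    rightCharacter χ (a ⊗ₜ b) = χ b.unop • a :=
  (Algebra.TensorProduct.lift_tmul ..).trans <| by
    rw [Algebra.smul_def, Algebra.commutes]
    rfl

/-- The bimodule given by a left module on which `A` is to act from the right through `χ`. -/
abbrev Inflation (χ : A →ₐ[K] K) (Y : Type*) : Type _ :=
  Restrict (rightCharacter χ : Enveloping K A →+* A) Y

theorem Inflation.tmul_smul {χ : A →ₐ[K] K} {Y : Type*} [AddCommGroup Y] [Module A Y] (a : A)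
    (b : Aᵐᵒᵖ) (y : Inflation χ Y) : (Restrict.of _).symm ((a ⊗ₜ b : Enveloping K A) • y) =
      (χ b.unop • a) • (Restrict.of (rightCharacter χ : Enveloping K A →+* A)).symm y := by
  rw [← rightCharacter_tmul]
  rfl

/-- The submodule `X · ker χ` of the left module underlying a bimodule `X`. -/
def kernelSubmodule (χ : A →ₐ[K] K) (X : Type*) [AddCommGroup X] [Module (Enveloping K A) X] :
    Submodule A (LeftModule K A X) :=
  Submodule.span A
    {y | ∃ (b : A) (x : X), χ b = 0 ∧ y = Restrict.of _ ((1 ⊗ₜ op b : Enveloping K A) • x)}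

/-- The left module `X ⊗_A S = X / (X · ker χ)` attached to a bimodule `X`, where `S` is the
one-dimensional module of the character `χ`. -/
abbrev Coinvariants (χ : A →ₐ[K] K) (X : Type*) [AddCommGroup X] [Module (Enveloping K A) X] :
    Type _ :=
  LeftModule K A X ⧸ kernelSubmodule χ X

namespace Coinvariants

variable {χ : A →ₐ[K] K} {X Y : Type*} [AddCommGroup X] [Module (Enveloping K A) X]
  [AddCommGroup Y] [Module (Enveloping K A) Y]

theorem of_smul_mem (a : A) {b : A} (hb : χ b = 0) (x : X) :
    Restrict.of _ ((a ⊗ₜ op b : Enveloping K A) • x) ∈ kernelSubmodule χ X := by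
  have h := Submodule.smul_mem _ a (Submodule.subset_span ⟨b, x, hb, rfl⟩ :
    Restrict.of _ ((1 ⊗ₜ op b : Enveloping K A) • x) ∈ kernelSubmodule χ X)
  rwa [Restrict.smul_of, smul_smul, Algebra.TensorProduct.includeLeftRingHom_apply,
    Algebra.TensorProduct.tmul_mul_tmul, mul_one, one_mul] at h

variable (χ X) in
/-- The quotient map, linear over the enveloping algebra when `A` acts on its target from the right
through `χ`. -/
def mk : X →ₗ[Enveloping K A] Inflation χ (Coinvariants χ X) where
  toFun x := Restrict.of _ ((kernelSubmodule χ X).mkQ (Restrict.of _ x))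
  map_add' x y := by simp only [map_add]
  map_smul' e x := by
    rw [RingHom.id_apply]
    induction e using TensorProduct.induction_on with
    | zero => simp only [Module.zero_smul, map_zero]
    | add e f he hf => simp only [add_smul, map_add, he, hf]
    | tmul a b =>
      refine (Restrict.of _).symm.injective ?_
      rw [Inflation.tmul_smul, AddEquiv.symm_apply_apply, AddEquiv.symm_apply_apply, ← map_smul,
        Restrict.smul_of]
      refine (Submodule.Quotient.eq _).2 ?_
      rw [← map_sub, ← sub_smul, Algebra.TensorProduct.includeLeftRingHom_apply,
        TensorProduct.smul_tmul, ← TensorProduct.tmul_sub]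
      exact of_smul_mem a (b := b.unop - χ b.unop • 1) (by simp) x

theorem mk_surjective : Function.Surjective (mk χ X) := (kernelSubmodule χ X).mkQ_surjective

theorem mk_eq_zero {x : X} : mk χ X x = 0 ↔ Restrict.of _ x ∈ kernelSubmodule χ X :=
  Submodule.Quotient.mk_eq_zero _

/-- A map from `X` to a left module on which `A` acts from the right through `χ` factors through
the coinvariants. -/
def lift {Y : Type*} [AddCommGroup Y] [Module A Y] (f : X →ₗ[Enveloping K A] Inflation χ Y) :
    Coinvariants χ X →ₗ[A] Y :=
  (kernelSubmodule χ X).liftQ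
    { toFun := fun x => (Restrict.of _).symm (f ((Restrict.of _).symm x))
      map_add' := fun x y => f.map_add _ _
      map_smul' := fun a x => by
        refine (congrArg (Restrict.of _).symm (f.map_smul (a ⊗ₜ 1) _)).trans ?_
        rw [Inflation.tmul_smul, unop_one, map_one, one_smul]
        rfl } <|
    Submodule.span_le.2 <| by
      rintro _ ⟨b, x, hb, rfl⟩
      refine (congrArg (Restrict.of _).symm (f.map_smul _ x)).trans ?_
      rw [Inflation.tmul_smul, unop_op, hb, zero_smul, zero_smul]

instance [Module.Projective (Enveloping K A) X] : Module.Projective A (Coinvariants χ X) :=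
  Module.Projective.of_lifting_property'' fun f hf => by
    obtain ⟨g, hg⟩ := Module.projective_lifting_property
      (Restrict.map (rightCharacter χ : Enveloping K A →+* A) f) (mk χ X) hf
    refine ⟨lift g, LinearMap.ext fun x => ?_⟩
    obtain ⟨x, rfl⟩ := mk_surjective x
    exact LinearMap.congr_fun hg x

/-- The map induced by a bimodule homomorphism. -/
def map (f : X →ₗ[Enveloping K A] Y) : Coinvariants χ X →ₗ[A] Coinvariants χ Y :=
  lift (mk χ Y ∘ₗ f)

theorem map_mk (f : X →ₗ[Enveloping K A] Y) (x : X) : map f (mk χ X x) = mk χ Y (f x) := rfl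

theorem map_kernelSubmodule {f : X →ₗ[Enveloping K A] Y} (hf : Function.Surjective f) :
    (kernelSubmodule χ X).map (Restrict.map _ f) = kernelSubmodule χ Y := by
  rw [kernelSubmodule, kernelSubmodule, Submodule.map_span]
  congr 1
  ext y
  constructor
  · rintro ⟨_, ⟨b, x, hb, rfl⟩, rfl⟩
    exact ⟨b, f x, hb, by rw [Restrict.map_of, map_smul]⟩
  · rintro ⟨b, y, hb, rfl⟩
    obtain ⟨x, rfl⟩ := hf y
    exact ⟨_, ⟨b, x, hb, rfl⟩, by rw [Restrict.map_of, map_smul]⟩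

theorem map_surjective {f : X →ₗ[Enveloping K A] Y} (hf : Function.Surjective f) :
    Function.Surjective (map f : Coinvariants χ X →ₗ[A] Coinvariants χ Y) := fun y => by
  obtain ⟨y, rfl⟩ := mk_surjective y
  obtain ⟨x, rfl⟩ := hf y
  exact ⟨_, map_mk f x⟩

variable {Z : Type*} [AddCommGroup Z] [Module (Enveloping K A) Z]

theorem map_exact {f : X →ₗ[Enveloping K A] Y} {g : Y →ₗ[Enveloping K A] Z}
    (hfg : Function.Exact f g) (hg : Function.Surjective g) :
    Function.Exact (map f : Coinvariants χ X →ₗ[A] Coinvariants χ Y) (map g) := fun y => by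
  obtain ⟨y, rfl⟩ := mk_surjective y
  constructor
  · intro hy
    have hgy : Restrict.of _ (g y) ∈ kernelSubmodule χ Z := mk_eq_zero.1 hy
    rw [← map_kernelSubmodule hg] at hgy
    obtain ⟨y', hy', hgy'⟩ := hgy
    obtain ⟨y', rfl⟩ := (Restrict.of _).surjective y'
    obtain ⟨x, hx⟩ := (hfg (y - y')).1 (by rw [map_sub, sub_eq_zero]; exact hgy'.symm)
    refine ⟨mk χ X x, ?_⟩
    rw [map_mk, hx, map_sub, mk_eq_zero.2 hy', sub_zero]
  · rintro ⟨x, hx⟩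
    obtain ⟨x, rfl⟩ := mk_surjective x
    rw [← hx, map_mk, map_mk, hfg.apply_apply_eq_zero, map_zero]
    rfl

theorem of_map_mem_kernelSubmodule {r : Y →+ X}
    (hr : ∀ (b : Aᵐᵒᵖ) y, r ((1 ⊗ₜ b : Enveloping K A) • y) = (1 ⊗ₜ b : Enveloping K A) • r y)
    {y : LeftModule K A Y} (hy : y ∈ kernelSubmodule χ Y) :
    Restrict.of _ (r ((Restrict.of _).symm y)) ∈ kernelSubmodule χ X := by
  induction hy using Submodule.closure_induction with
  | zero => simp only [map_zero, zero_mem]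
  | add y z _ _ hy hz => simpa only [map_add] using add_mem hy hz
  | smul_mem a y hy =>
    obtain ⟨b, y, hb, rfl⟩ := hy
    have hab : (a ⊗ₜ 1 : Enveloping K A) • (1 ⊗ₜ op b : Enveloping K A) • y
        = (1 ⊗ₜ op b : Enveloping K A) • (a ⊗ₜ 1 : Enveloping K A) • y := by
      simp only [smul_smul, Algebra.TensorProduct.tmul_mul_tmul, mul_one, one_mul]
    rw [Restrict.smul_of, AddEquiv.symm_apply_apply,
      Algebra.TensorProduct.includeLeftRingHom_apply, hab, hr]
    exact of_smul_mem 1 hb _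

theorem map_injective {f : X →ₗ[Enveloping K A] Y} {r : Y →+ X}
    (hr : ∀ (b : Aᵐᵒᵖ) y, r ((1 ⊗ₜ b : Enveloping K A) • y) = (1 ⊗ₜ b : Enveloping K A) • r y)
    (hrf : ∀ x, r (f x) = x) :
    Function.Injective (map f : Coinvariants χ X →ₗ[A] Coinvariants χ Y) := by
  refine (injective_iff_map_eq_zero _).2 fun x hx => ?_
  obtain ⟨x, rfl⟩ := mk_surjective x
  have h := of_map_mem_kernelSubmodule hr (mk_eq_zero.1 hx)
  rw [AddEquiv.symm_apply_apply, hrf] at h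
  exact mk_eq_zero.2 h

end Coinvariants

theorem IsStableSyzygy.coinvariants {M N : Type v} [AddCommGroup M] [AddCommGroup N]
    [Module (Enveloping K A) M] [Module (Enveloping K A) N]
    [Module.Projective Aᵐᵒᵖ (RightModule K A M)] (h : IsStableSyzygy (Enveloping K A) M N)
    (χ : A →ₐ[K] K) : IsStableSyzygy A (Coinvariants χ M) (Coinvariants χ N) := by
  obtain ⟨P, _, _, j, π, _, hj, hjπ, hπ⟩ := h
  obtain ⟨r, hr⟩ := exists_rightModule_retraction hj hjπ hπ
  exact ⟨Coinvariants χ P, _, _, Coinvariants.map j, Coinvariants.map π, inferInstance,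
    Coinvariants.map_injective (r := r.toAddMonoidHom) r.map_smul (LinearMap.congr_fun hr),
    Coinvariants.map_exact hjπ hπ, Coinvariants.map_surjective hπ⟩

section Regular

attribute [local instance] TensorProduct.Algebra.module

instance : Module.Projective Aᵐᵒᵖ (RightModule K A A) :=
  Module.Projective.of_equiv' (M := Aᵐᵒᵖ)
    { (opAddEquiv : A ≃+ Aᵐᵒᵖ).symm with
      map_smul' := fun b x => (one_smul A (b • x.unop)).symm }

variable (χ : A →ₐ[K] K)

/-- The augmentation of the regular bimodule, as a homomorphism of left modules. -/
def regularProj : LeftModule K A A →ₗ[A] OneDim χ where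
  toFun x := χ ((Restrict.of _).symm x)
  map_add' := map_add χ
  map_smul' a x := (congrArg (fun y : A => χ (a * y)) (one_smul Aᵐᵒᵖ (show A from x))).trans <|
    map_mul χ a _

theorem regularProj_of (x : A) : regularProj χ (Restrict.of _ x) = χ x := rfl

theorem ker_regularProj : LinearMap.ker (regularProj χ) = kernelSubmodule χ A := by
  refine le_antisymm (fun x hx => ?_) (Submodule.span_le.2 ?_)
  · obtain ⟨x, rfl⟩ := (Restrict.of _).surjective x
    refine Submodule.subset_span ⟨x, 1, hx, ?_⟩
    rw [TensorProduct.Algebra.smul_def, one_smul, op_smul_eq_mul, one_mul]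
  · rintro _ ⟨b, x, hb, rfl⟩
    rw [SetLike.mem_coe, LinearMap.mem_ker, regularProj_of, TensorProduct.Algebra.smul_def,
      one_smul, op_smul_eq_mul, map_mul, hb, mul_zero]
    rfl

/-- The left module `A ⊗_A S` is the one-dimensional module `S`. -/
def Coinvariants.regularEquiv : Coinvariants χ A ≃ₗ[A] OneDim χ :=
  (Submodule.quotEquivOfEq _ _ (ker_regularProj χ).symm).trans <|
    (regularProj χ).quotKerEquivOfSurjective fun c => ⟨algebraMap K A c, χ.commutes c⟩

end Regular
end Enveloping

namespace PathAlgebra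

section Paths

variable {K : Type u} {V : Type v} [Field K] [Quiver.{w} V]

/-- The coefficient of a path, as a linear form on the path algebra. -/
def coeffHom (K : Type u) [Field K] {a b : V} (p : Quiver.Path a b) : PathAlgebra K V →ₗ[K] K :=
  (Finsupp.lapply (⟨a, b, p⟩ : QuiverPath V) : (QuiverPath V →₀ K) →ₗ[K] K)

theorem coeffHom_ofPath_self {a b : V} (p : Quiver.Path a b) : coeffHom K p (ofPath K p) = 1 :=
  Finsupp.single_eq_same

theorem coeffHom_ofPath_of_ne {a b c d : V} {p : Quiver.Path a b} {q : Quiver.Path c d}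
    (h : (⟨c, d, q⟩ : QuiverPath V) ≠ ⟨a, b, p⟩) : coeffHom K p (ofPath K q) = 0 :=
  Finsupp.single_eq_of_ne h.symm

theorem ofPath_mul_ofPath {a b c : V} (p : Quiver.Path a b) (q : Quiver.Path b c) :
    ofPath K p * ofPath K q = ofPath K (p.comp q) :=
  (mulHom_ofPath K p q).trans (pathMul_comp K p q)

theorem ofPath_mul_ofPath_of_ne {a b c d : V} (p : Quiver.Path a b) (q : Quiver.Path c d)
    (h : b ≠ c) : ofPath K p * ofPath K q = 0 :=
  (mulHom_ofPath K p q).trans (pathMul_of_ne K p q h)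

variable (K V) in
/-- The span of the paths of length at least `n`, that is, the `n`-th power of the arrow ideal. -/
def lengthGE (n : ℕ) : Submodule K (PathAlgebra K V) :=
  Submodule.span K {x | ∃ (a b : V) (p : Quiver.Path a b), n ≤ p.length ∧ x = ofPath K p}

theorem ofPath_mem_lengthGE {n : ℕ} {a b : V} {p : Quiver.Path a b} (h : n ≤ p.length) :
    ofPath K p ∈ lengthGE K V n :=
  Submodule.subset_span ⟨a, b, p, h, rfl⟩

theorem mem_lengthGE_zero (x : PathAlgebra K V) : x ∈ lengthGE K V 0 := by
  induction x using induction_on with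
  | zero => exact zero_mem _
  | add y z hy hz => exact add_mem hy hz
  | smul_path c a b p => exact Submodule.smul_mem _ c (ofPath_mem_lengthGE (Nat.zero_le _))

theorem coeffHom_eq_zero_of_mem_lengthGE {n : ℕ} {a b : V} {p : Quiver.Path a b}
    (h : p.length < n) {x : PathAlgebra K V} (hx : x ∈ lengthGE K V n) : coeffHom K p x = 0 := by
  refine Submodule.span_le (p := LinearMap.ker (coeffHom K p)).2 ?_ hx
  rintro _ ⟨c, d, q, hq, rfl⟩
  refine coeffHom_ofPath_of_ne fun hqp => ?_
  have hlen : q.length = p.length := congrArg (fun r : QuiverPath V => r.2.2.length) hqp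
  omega

theorem sigma_eq_of_comp_eq {a b b' c : V} {p : Quiver.Path a b} {q : Quiver.Path b c}
    {p' : Quiver.Path a b'} {q' : Quiver.Path b' c} (hq : q'.length = q.length)
    (h : p'.comp q' = p.comp q) :
    (⟨a, b', p'⟩ : QuiverPath V) = ⟨a, b, p⟩ ∧ (⟨b', c, q'⟩ : QuiverPath V) = ⟨b, c, q⟩ := by
  induction q with
  | nil =>
    cases q' with
    | nil => exact ⟨congrArg (fun r => (⟨a, _, r⟩ : QuiverPath V)) h, rfl⟩
    | cons => exact absurd hq (Nat.succ_ne_zero _)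
  | cons q β ih =>
    cases q' with
    | nil => exact absurd hq (Nat.succ_ne_zero _).symm
    | cons q' β' =>
      obtain ⟨rfl, hcomp, hβ⟩ := Quiver.Path.cons.inj h
      obtain ⟨hp, ⟨⟩⟩ := ih (Nat.succ.inj hq) (eq_of_heq hcomp)
      exact ⟨hp, by rw [eq_of_heq hβ]⟩

theorem coeffHom_comp_ofPath_mul_ofPath {a b c a' b' b'' c' : V} {p : Quiver.Path a b}
    {q : Quiver.Path b c} {p' : Quiver.Path a' b'} {q' : Quiver.Path b'' c'}
    (hp : p.length ≤ p'.length) (hq : q.length ≤ q'.length) :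
    coeffHom K (p.comp q) (ofPath K p' * ofPath K q') =
      coeffHom K p (ofPath K p') * coeffHom K q (ofPath K q') := by
  by_cases h : (⟨a', b', p'⟩ : QuiverPath V) = ⟨a, b, p⟩ ∧
      (⟨b'', c', q'⟩ : QuiverPath V) = ⟨b, c, q⟩
  · obtain ⟨⟨⟩, ⟨⟩⟩ := h
    rw [ofPath_mul_ofPath, coeffHom_ofPath_self, coeffHom_ofPath_self, coeffHom_ofPath_self,
      mul_one]
  · have hright : coeffHom K p (ofPath K p') * coeffHom K q (ofPath K q') = 0 := by
      rcases not_and_or.1 h with h | h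
      · rw [coeffHom_ofPath_of_ne h, zero_mul]
      · rw [coeffHom_ofPath_of_ne h, mul_zero]
    rw [hright]
    rcases eq_or_ne b' b'' with rfl | hb
    · rw [ofPath_mul_ofPath]
      refine coeffHom_ofPath_of_ne fun hpq => h ?_
      have hlen : (p'.comp q').length = (p.comp q).length :=
        congrArg (fun r : QuiverPath V => r.2.2.length) hpq
      rw [Quiver.Path.length_comp, Quiver.Path.length_comp] at hlen
      obtain ⟨rfl, hpq⟩ := Sigma.mk.inj hpq
      obtain ⟨rfl, hpq⟩ := Sigma.mk.inj (eq_of_heq hpq)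
      exact sigma_eq_of_comp_eq (by omega) (eq_of_heq hpq)
    · rw [ofPath_mul_ofPath_of_ne _ _ hb, map_zero]

theorem coeffHom_comp_mul {a b c : V} (p : Quiver.Path a b) (q : Quiver.Path b c)
    {x y : PathAlgebra K V} (hx : x ∈ lengthGE K V p.length) (hy : y ∈ lengthGE K V q.length) :
    coeffHom K (p.comp q) (x * y) = coeffHom K p x * coeffHom K q y := by
  change coeffHom K (p.comp q) (mulHom K x y) = LinearMap.mul K K (coeffHom K p x) (coeffHom K q y)
  induction hx, hy using Submodule.span_induction₂ with
  | mem_mem _ _ hx hy =>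
    obtain ⟨a', b', p', hp, rfl⟩ := hx
    obtain ⟨b'', c', q', hq, rfl⟩ := hy
    exact coeffHom_comp_ofPath_mul_ofPath hp hq
  | zero_left y => simp only [map_zero, LinearMap.zero_apply]
  | zero_right x => simp only [map_zero]
  | add_left x y z _ _ _ hx hy => simp only [map_add, LinearMap.add_apply, hx, hy]
  | add_right x y z _ _ _ hy hz => simp only [map_add, hy, hz]
  | smul_left r x y _ _ h => simp only [map_smul, LinearMap.smul_apply, h]
  | smul_right r x y _ _ h => simp only [map_smul, h]

theorem mul_mem_lengthGE {m n : ℕ} {x y : PathAlgebra K V} (hx : x ∈ lengthGE K V m)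
    (hy : y ∈ lengthGE K V n) : x * y ∈ lengthGE K V (m + n) := by
  have h : Submodule.map₂ (mulHom K) (lengthGE K V m) (lengthGE K V n) ≤
      lengthGE K V (m + n) := by
    rw [lengthGE, lengthGE, Submodule.map₂_span_span, Submodule.span_le]
    rintro _ ⟨_, ⟨a, b, p, hp, rfl⟩, _, ⟨c, d, q, hq, rfl⟩, rfl⟩
    change ofPath K p * ofPath K q ∈ lengthGE K V (m + n)
    rcases eq_or_ne b c with rfl | hbc
    · rw [ofPath_mul_ofPath]
      exact ofPath_mem_lengthGE (by rw [Quiver.Path.length_comp]; exact add_le_add hp hq)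
    · rw [ofPath_mul_ofPath_of_ne p q hbc]
      exact zero_mem _
  exact h (Submodule.apply_mem_map₂ _ hx hy)

end Paths

section Ring

variable {K : Type u} {V : Type v} [Field K] [Quiver.{w} V] [Fintype V]

theorem coeffHom_mul_congr {a b : V} {γ : Quiver.Path a b} {n : ℕ} (hγ : γ.length = n)
    {r x y : PathAlgebra K V} (hr : r ∈ lengthGE K V 1) (hxy : x - y ∈ lengthGE K V n) :
    coeffHom K γ (r * x) = coeffHom K γ (r * y) := by
  rw [← sub_eq_zero, ← map_sub, ← mul_sub]
  exact coeffHom_eq_zero_of_mem_lengthGE (by omega) (mul_mem_lengthGE hr hxy)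

theorem mem_lengthGE_of_mem_arrowIdeal {x : PathAlgebra K V} (hx : x ∈ arrowIdeal K V) :
    x ∈ lengthGE K V 1 := by
  let J : TwoSidedIdeal (PathAlgebra K V) := TwoSidedIdeal.mk' (lengthGE K V 1 : Set _)
    (zero_mem _) add_mem neg_mem
    (fun {x y} hy => by
      simpa only [zero_add, SetLike.mem_coe] using mul_mem_lengthGE (mem_lengthGE_zero x) hy)
    (fun {x y} hx => by
      simpa only [add_zero, SetLike.mem_coe] using mul_mem_lengthGE hx (mem_lengthGE_zero y))
  have hJ (y : PathAlgebra K V) : y ∈ J ↔ y ∈ lengthGE K V 1 := TwoSidedIdeal.mem_mk' ..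
  refine (hJ x).1 (TwoSidedIdeal.span_le.2 ?_ (TwoSidedIdeal.mem_asIdeal.1 hx))
  rintro _ ⟨a, b, α, rfl⟩
  exact (hJ _).2 (ofPath_mem_lengthGE (Quiver.Path.length_toPath α).ge)

theorem mem_lengthGE_of_mem_arrowIdeal_pow {n : ℕ} {x : PathAlgebra K V}
    (hx : x ∈ arrowIdeal K V ^ n) : x ∈ lengthGE K V n := by
  induction n generalizing x with
  | zero => exact mem_lengthGE_zero x
  | succ n ih =>
    rw [Submodule.pow_succ] at hx
    induction hx using Submodule.mul_induction_on' with
    | mem_mul_mem y hy z hz => exact mul_mem_lengthGE (ih hy) (mem_lengthGE_of_mem_arrowIdeal hz)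
    | add y _ z _ hy hz => exact add_mem hy hz

theorem ofPath_mem_arrowIdeal_pow {n : ℕ} {a b : V} {p : Quiver.Path a b} (h : n ≤ p.length) :
    ofPath K p ∈ arrowIdeal K V ^ n := by
  induction n generalizing b with
  | zero => simp only [Submodule.pow_zero, Ideal.one_eq_top, Submodule.mem_top]
  | succ n ih =>
    cases p with
    | nil => exact absurd h (Nat.not_succ_le_zero n)
    | cons p α =>
      rw [Submodule.pow_succ, ← Quiver.Path.comp_toPath_eq_cons, ← ofPath_mul_ofPath]
      exact Ideal.mul_mem_mul (ih (Nat.le_of_succ_le_succ h))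
        (TwoSidedIdeal.mem_asIdeal.2 (TwoSidedIdeal.subset_span ⟨_, _, α, rfl⟩))

/-- The character of the path algebra given by the coefficient of the trivial path at `l`. -/
def vertexCharacter (K : Type u) [Field K] (l : V) : PathAlgebra K V →ₐ[K] K :=
  AlgHom.ofLinearMap (coeffHom K (Quiver.Path.nil : Quiver.Path l l))
    (by
      change coeffHom K _ (∑ a : V, ofPath K (Quiver.Path.nil : Quiver.Path a a)) = 1
      rw [map_sum, Finset.sum_eq_single_of_mem l (Finset.mem_univ l), coeffHom_ofPath_self]
      exact fun a _ ha => coeffHom_ofPath_of_ne fun h => ha (congrArg Sigma.fst h))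
    fun x y => coeffHom_comp_mul .nil .nil (mem_lengthGE_zero x) (mem_lengthGE_zero y)

theorem coeffHom_mul_of_mem_left {a b : V} (p : Quiver.Path a b) {x : PathAlgebra K V}
    (hx : x ∈ lengthGE K V p.length) (y : PathAlgebra K V) :
    coeffHom K p (x * y) = coeffHom K p x * vertexCharacter K b y :=
  coeffHom_comp_mul p .nil hx (mem_lengthGE_zero y)

theorem coeffHom_mul_of_mem_right {a b : V} (p : Quiver.Path a b) (x : PathAlgebra K V)
    {y : PathAlgebra K V} (hy : y ∈ lengthGE K V p.length) :
    coeffHom K p (x * y) = vertexCharacter K a x * coeffHom K p y := by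
  have h := coeffHom_comp_mul .nil p (mem_lengthGE_zero x) hy
  rwa [Quiver.Path.nil_comp] at h

theorem vertexCharacter_nil_self (l : V) :
    vertexCharacter K l (ofPath K (.nil : Quiver.Path l l)) = 1 :=
  coeffHom_ofPath_self _

theorem vertexCharacter_nil_of_ne {l m : V} (h : m ≠ l) :
    vertexCharacter K l (ofPath K (.nil : Quiver.Path m m)) = 0 :=
  coeffHom_ofPath_of_ne fun h' => h (congrArg Sigma.fst h')

theorem vertexCharacter_eq_zero (l : V) {x : PathAlgebra K V} (hx : x ∈ lengthGE K V 1) :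
    vertexCharacter K l x = 0 :=
  coeffHom_eq_zero_of_mem_lengthGE (p := (.nil : Quiver.Path l l)) one_pos hx

theorem vertexCharacter_cons (l : V) {a b c : V} (p : Quiver.Path a b) (α : b ⟶ c) :
    vertexCharacter K l (ofPath K (p.cons α)) = 0 :=
  vertexCharacter_eq_zero l (ofPath_mem_lengthGE (Nat.succ_pos _))

theorem ker_vertexCharacter_le_span (i : V) : RingHom.ker (vertexCharacter K i) ≤
    Ideal.span ({x | ∃ l, l ≠ i ∧ x = ofPath K (.nil : Quiver.Path l l)} ∪
      {x | ∃ (l : V) (α : l ⟶ i), x = ofPath K α.toPath}) := by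
  set G := Ideal.span ({x | ∃ l, l ≠ i ∧ x = ofPath K (.nil : Quiver.Path l l)} ∪
    {x | ∃ (l : V) (α : l ⟶ i), x = ofPath K α.toPath})
  suffices h : ∀ x, x - vertexCharacter K i x • ofPath K (.nil : Quiver.Path i i) ∈ G by
    intro x hx
    rw [RingHom.mem_ker] at hx
    simpa only [hx, zero_smul, sub_zero] using h x
  intro x
  induction x using induction_on with
  | zero => simp only [map_zero, zero_smul, sub_zero, zero_mem]
  | add x y hx hy => simpa only [map_add, add_smul, add_sub_add_comm] using add_mem hx hy
  | smul_path c a b p =>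
    rw [map_smul, smul_assoc, ← smul_sub, Algebra.smul_def]
    refine G.mul_mem_left _ ?_
    rcases eq_or_ne b i with rfl | hb
    · cases p with
      | nil => simp only [vertexCharacter_nil_self, one_smul, sub_self, zero_mem]
      | cons p α =>
        rw [vertexCharacter_cons, zero_smul, sub_zero, ← Quiver.Path.comp_toPath_eq_cons,
          ← ofPath_mul_ofPath]
        exact G.mul_mem_left _ (Ideal.subset_span (.inr ⟨_, α, rfl⟩))
    · have hp : vertexCharacter K i (ofPath K p) = 0 :=
        coeffHom_ofPath_of_ne fun h => hb (congrArg (fun r : QuiverPath V => r.2.1) h)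
      rw [hp, zero_smul, sub_zero, ← Quiver.Path.comp_nil p, ← ofPath_mul_ofPath]
      exact G.mul_mem_left _ (Ideal.subset_span (.inl ⟨b, hb, rfl⟩))

theorem extVanishes_vertexCharacter {i k : V} [IsEmpty (k ⟶ i)] :
    ExtVanishes (vertexCharacter K i) (OneDim (vertexCharacter K k)) := by
  intro φ
  obtain ⟨x₀, hx₀⟩ : ∃ x₀, ∀ hk : k ≠ i,
      φ ⟨ofPath K .nil, vertexCharacter_nil_of_ne hk⟩ = x₀ := by
    by_cases hk : k ≠ i
    · exact ⟨φ ⟨ofPath K .nil, vertexCharacter_nil_of_ne hk⟩, fun _ => rfl⟩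
    · exact ⟨0, fun h => absurd h hk⟩
  let ψ := φ - LinearMap.toSpanSingleton _ _ x₀ ∘ₗ (RingHom.ker (vertexCharacter K i)).subtype
  have hψ {l : V} (hl : l ≠ k) (u : RingHom.ker (vertexCharacter K i))
      (hu : ofPath K (.nil : Quiver.Path l l) • u = u) : ψ u = 0 := by
    rw [← hu, map_smul, OneDim.smul_eq, vertexCharacter_nil_of_ne hl, zero_smul]
  have hle : RingHom.ker (vertexCharacter K i) ≤
      (LinearMap.ker ψ).map (RingHom.ker (vertexCharacter K i)).subtype := by
    refine (ker_vertexCharacter_le_span i).trans (Submodule.span_le.2 ?_)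
    rintro _ (⟨l, hl, rfl⟩ | ⟨l, α, rfl⟩)
    · refine ⟨⟨_, vertexCharacter_nil_of_ne hl⟩, ?_, rfl⟩
      rcases eq_or_ne l k with rfl | hlk
      · refine sub_eq_zero.2 ((hx₀ hl).trans ?_)
        exact ((congrArg (· • x₀) (vertexCharacter_nil_self l)).trans (one_smul K x₀)).symm
      · exact hψ hlk _ (Subtype.ext (ofPath_mul_ofPath .nil .nil))
    · have hlk : l ≠ k := fun h => IsEmpty.false (h ▸ α : k ⟶ i)
      refine ⟨⟨_, vertexCharacter_cons i .nil α⟩, hψ hlk _ (Subtype.ext ?_), rfl⟩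
      exact (ofPath_mul_ofPath .nil _).trans (congrArg _ (Quiver.Path.nil_comp _))
  refine ⟨x₀, fun u => ?_⟩
  obtain ⟨u', hu', huu'⟩ := hle u.2
  exact Subtype.ext huu' ▸ sub_eq_zero.1 hu'

end Ring

section Quotient

theorem finite_setOf_length_eq {V : Type v} [Quiver.{w} V] [Finite V] [∀ a b : V, Finite (a ⟶ b)]
    (n : ℕ) : {p : QuiverPath V | p.2.2.length = n}.Finite := by
  induction n with
  | zero =>
    refine (Set.finite_range fun a : V => (⟨a, a, .nil⟩ : QuiverPath V)).subset ?_
    rintro ⟨a, b, p⟩ hp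
    cases p with
    | nil => exact ⟨a, rfl⟩
    | cons => exact absurd hp (Nat.succ_ne_zero _)
  | succ n ih =>
    have := ih.to_subtype
    refine (Set.finite_range fun x : Σ (p : {p : QuiverPath V | p.2.2.length = n}) (c : V),
      p.1.2.1 ⟶ c => (⟨x.1.1.1, x.2.1, x.1.1.2.2.cons x.2.2⟩ : QuiverPath V)).subset ?_
    rintro ⟨a, b, p⟩ hp
    cases p with
    | nil => exact absurd hp (Nat.succ_ne_zero _).symm
    | cons p α => exact ⟨⟨⟨⟨a, _, p⟩, Nat.succ.inj hp⟩, _, α⟩, rfl⟩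

variable {K : Type u} {V : Type v} [Field K] [Quiver.{w} V] [Fintype V]
  {I : Ideal (PathAlgebra K V)}

theorem IsAdmissible.mem_lengthGE (hI : IsAdmissible I) {x : PathAlgebra K V} (hx : x ∈ I) :
    x ∈ lengthGE K V 2 :=
  mem_lengthGE_of_mem_arrowIdeal_pow (hI.2.1 hx)

variable [I.IsTwoSided]

theorem IsAdmissible.finiteDimensional [∀ a b : V, Finite (a ⟶ b)] (hI : IsAdmissible I) :
    FiniteDimensional K (PathAlgebra K V ⧸ I) := by
  obtain ⟨-, -, m, -, hm⟩ := hI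
  have hfin : {p : QuiverPath V | p.2.2.length < m}.Finite := by
    refine ((Set.finite_lt_nat m).biUnion fun n _ => finite_setOf_length_eq (V := V) n).subset ?_
    exact fun p hp => Set.mem_biUnion hp rfl
  refine ⟨Submodule.fg_def.2 ⟨_, hfin.image fun p => Ideal.Quotient.mkₐ K I (ofPath K p.2.2), ?_⟩⟩
  refine Submodule.eq_top_iff'.2 fun a => ?_
  obtain ⟨x, rfl⟩ := Ideal.Quotient.mkₐ_surjective K I a
  induction x using induction_on with
  | zero => rw [map_zero]; exact zero_mem _
  | add y z hy hz => rw [map_add]; exact add_mem hy hz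
  | smul_path c a b p =>
    rw [map_smul]
    refine Submodule.smul_mem _ c ?_
    rcases lt_or_ge p.length m with hp | hp
    · exact Submodule.subset_span ⟨⟨a, b, p⟩, hp, rfl⟩
    · have hp0 : Ideal.Quotient.mkₐ K I (ofPath K p) = 0 :=
        Ideal.Quotient.eq_zero_iff_mem.2 (hm (ofPath_mem_arrowIdeal_pow hp))
      exact hp0 ▸ zero_mem _

/-- The character of `K Q / I` induced by `vertexCharacter`: the action on the simple module at the
vertex `l`. -/
def quotientCharacter (hI : IsAdmissible I) (l : V) : PathAlgebra K V ⧸ I →ₐ[K] K :=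
  Ideal.Quotient.liftₐ I (vertexCharacter K l) fun _ hx =>
    coeffHom_eq_zero_of_mem_lengthGE (p := (.nil : Quiver.Path l l)) two_pos (hI.mem_lengthGE hx)

theorem quotientCharacter_mk (hI : IsAdmissible I) (l : V) (x : PathAlgebra K V) :
    quotientCharacter hI l (Ideal.Quotient.mk I x) = vertexCharacter K l x := rfl

/-- The quotient map, restricted to the kernels of the characters at the vertex `l`. -/
def kerMk (hI : IsAdmissible I) (l : V) :
    RingHom.ker (vertexCharacter K l) →ₛₗ[Ideal.Quotient.mk I]
      RingHom.ker (quotientCharacter hI l) where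
  toFun x := ⟨Ideal.Quotient.mk I x, x.2⟩
  map_add' x y := Subtype.ext (map_add (Ideal.Quotient.mk I) (x : PathAlgebra K V) y)
  map_smul' r x := Subtype.ext (map_mul (Ideal.Quotient.mk I) r (x : PathAlgebra K V))

theorem kerMk_surjective (hI : IsAdmissible I) (l : V) : Function.Surjective (kerMk hI l) := by
  rintro ⟨a, ha⟩
  obtain ⟨x, rfl⟩ := Ideal.Quotient.mk_surjective a
  exact ⟨⟨x, ha⟩, rfl⟩

theorem extVanishes_quotientCharacter (hI : IsAdmissible I) {i k : V} [IsEmpty (k ⟶ i)] :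
    ExtVanishes (quotientCharacter hI i) (OneDim (quotientCharacter hI k)) := by
  intro φ
  let ψ : RingHom.ker (vertexCharacter K i) →ₗ[PathAlgebra K V] OneDim (vertexCharacter K k) :=
    { toFun := fun x => φ (kerMk hI i x)
      map_add' := fun x y => by rw [map_add, map_add]; rfl
      map_smul' := fun r x => by rw [map_smulₛₗ, map_smul]; rfl }
  obtain ⟨x₀, hx₀⟩ := extVanishes_vertexCharacter ψ
  refine ⟨x₀, fun u => ?_⟩
  obtain ⟨x, rfl⟩ := kerMk_surjective hI i u
  exact hx₀ x

/-- The left module `J / I J` over `K Q / I`, where `J` is the kernel of the character at `l`. It is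
the term in degree one of Gruenberg's projective resolution of the simple module at `l`. -/
abbrev GruenbergModule (I : Ideal (PathAlgebra K V)) (l : V) : Type _ :=
  RingHom.ker (vertexCharacter K l) ⧸
    (I • ⊤ : Submodule (PathAlgebra K V) (RingHom.ker (vertexCharacter K l)))

namespace GruenbergModule

/-- The homomorphism `J / I J → J / I`. -/
def toKer (hI : IsAdmissible I) (l : V) :
    GruenbergModule I l →ₗ[PathAlgebra K V ⧸ I] RingHom.ker (quotientCharacter hI l) where
  __ := Submodule.liftQ _ (kerMk hI l) <| Submodule.smul_le.2 fun x hx m _ =>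
    Subtype.ext (Ideal.Quotient.eq_zero_iff_mem.2 (I.mul_mem_right _ hx))
  map_smul' a n := by
    obtain ⟨x, rfl⟩ := Ideal.Quotient.mk_surjective a
    obtain ⟨m, rfl⟩ := Submodule.Quotient.mk_surjective _ n
    exact map_smulₛₗ (kerMk hI l) x m

theorem toKer_surjective (hI : IsAdmissible I) (l : V) : Function.Surjective (toKer hI l) :=
  fun a => by
    obtain ⟨x, rfl⟩ := kerMk_surjective hI l a
    exact ⟨Submodule.Quotient.mk x, rfl⟩

variable {a b : V} {γ : Quiver.Path a b}

/-- The coefficient of a path `γ` of length two. -/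
def coeff (hI : IsAdmissible I) (hγ : γ.length = 2) : GruenbergModule I b →+ K :=
  QuotientAddGroup.lift (I • ⊤ : Submodule (PathAlgebra K V) _).toAddSubgroup
    ((coeffHom K γ).toAddMonoidHom.comp (RingHom.ker (vertexCharacter K b)).subtype.toAddMonoidHom)
    fun x hx => by
      refine Submodule.smul_induction_on (p := fun x : RingHom.ker (vertexCharacter K b) =>
        coeffHom K γ (x : PathAlgebra K V) = 0) hx (fun r hr m _ => ?_) fun x y hx hy => ?_
      · refine (coeffHom_mul_of_mem_left γ (hγ ▸ hI.mem_lengthGE hr) _).trans ?_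
        rw [show vertexCharacter K b m = 0 from m.2, mul_zero]
      · rw [Submodule.coe_add, map_add, hx, hy, add_zero]

theorem coeff_mk_smul_mk (hI : IsAdmissible I) (hγ : γ.length = 2) (r : PathAlgebra K V)
    (m : RingHom.ker (vertexCharacter K b)) :
    coeff hI hγ (Ideal.Quotient.mk I r • (Submodule.Quotient.mk m : GruenbergModule I b)) =
      coeffHom K γ (r * m) := rfl

/-- The coefficient of a path `γ` of length two from `a` to `b`, as a homomorphism from the kernel
`I / I J` of `J / I J → J / I` to the simple module at `a`. -/
def kerCoeff (hI : IsAdmissible I) (hγ : γ.length = 2) :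
    LinearMap.ker (toKer hI b) →ₗ[PathAlgebra K V ⧸ I] OneDim (quotientCharacter hI a) where
  toFun n := coeff hI hγ n
  map_add' n n' := map_add (coeff hI hγ) (n : GruenbergModule I b) n'
  map_smul' u n := by
    obtain ⟨x, rfl⟩ := Ideal.Quotient.mk_surjective u
    obtain ⟨n, hn⟩ := n
    obtain ⟨m, rfl⟩ := Submodule.Quotient.mk_surjective _ n
    have hm : (m : PathAlgebra K V) ∈ I :=
      Ideal.Quotient.eq_zero_iff_mem.1 (congrArg Subtype.val hn)
    exact coeffHom_mul_of_mem_right γ x (hγ ▸ hI.mem_lengthGE hm)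

theorem coeff_smul_eq_of_toKer_eq (hI : IsAdmissible I) (hγ : γ.length = 2)
    {r m h : PathAlgebra K V} (hr : r ∈ lengthGE K V 1) (hm : m ∈ lengthGE K V 1)
    (hh : vertexCharacter K b h = 1) {n : GruenbergModule I b}
    (hn : (toKer hI b n : PathAlgebra K V ⧸ I) = Ideal.Quotient.mk I (m * h)) :
    coeff hI hγ (Ideal.Quotient.mk I r • n) = coeffHom K γ (r * m) := by
  obtain ⟨x, rfl⟩ := Submodule.Quotient.mk_surjective _ n
  have hx : (x : PathAlgebra K V) - m * h ∈ I := Ideal.Quotient.eq.1 hn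
  have hrm : r * m ∈ lengthGE K V γ.length := by
    rw [hγ]
    exact mul_mem_lengthGE (m := 1) (n := 1) hr hm
  rw [coeff_mk_smul_mk, coeffHom_mul_congr hγ hr (hI.mem_lengthGE hx), ← mul_assoc,
    coeffHom_mul_of_mem_left γ hrm, hh, mul_one]

end GruenbergModule

/-- Here `d : Q → P` is part of a projective resolution of the simple module at `k`, and `f`, `g`
compare it with Gruenberg's resolution. -/
theorem exists_smul_eq_zero_of_mem_arrowIdeal_sq (hI : IsAdmissible I) {i k : V}
    {γ : Quiver.Path i k} (hγ : γ.length = 2) {s : PathAlgebra K V ⧸ I}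
    (hs : ∀ u, s * u = quotientCharacter hI i u • s) {P Q : Type*} [AddCommGroup P]
    [Module (PathAlgebra K V ⧸ I) P] [AddCommGroup Q] [Module (PathAlgebra K V ⧸ I) Q]
    {d : Q →ₗ[PathAlgebra K V ⧸ I] P} {f : P →ₗ[PathAlgebra K V ⧸ I] PathAlgebra K V ⧸ I}
    {g : Q →ₗ[PathAlgebra K V ⧸ I] GruenbergModule I k}
    (hfg : ∀ q, (GruenbergModule.toKer hI k (g q) : PathAlgebra K V ⧸ I) = f (d q)) {p : P}
    (hp : quotientCharacter hI k (f p) = 1)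
    (hd : ∀ u, quotientCharacter hI k u = 0 → ∃ q, d q = u • p)
    {x : PathAlgebra K V} (hx : x ∈ arrowIdeal K V ^ 2) :
    ∃ q, d q = Ideal.Quotient.mk I x • p ∧ s • q = 0 ∧
      GruenbergModule.coeff hI hγ (g q) = coeffHom K γ x := by
  rw [Submodule.pow_succ, Submodule.pow_one] at hx
  induction hx using Submodule.mul_induction_on' with
  | add x _ y _ hx hy =>
    obtain ⟨q, hdq, hsq, hcq⟩ := hx
    obtain ⟨q', hdq', hsq', hcq'⟩ := hy
    exact ⟨q + q', by rw [map_add, hdq, hdq', map_add, add_smul],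
      by rw [smul_add, hsq, hsq', add_zero], by rw [map_add, map_add, hcq, hcq', map_add]⟩
  | mem_mul_mem r hr m hm =>
    have hr := mem_lengthGE_of_mem_arrowIdeal hr
    have hm := mem_lengthGE_of_mem_arrowIdeal hm
    obtain ⟨q, hq⟩ := hd (Ideal.Quotient.mk I m) (vertexCharacter_eq_zero k hm)
    refine ⟨Ideal.Quotient.mk I r • q, by rw [map_smul, hq, smul_smul, map_mul], ?_, ?_⟩
    · rw [smul_smul, hs, quotientCharacter_mk, vertexCharacter_eq_zero i hr, zero_smul, zero_smul]
    · obtain ⟨h, hh⟩ := Ideal.Quotient.mk_surjective (f p)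
      have hgq : (GruenbergModule.toKer hI k (g q) : PathAlgebra K V ⧸ I) =
          Ideal.Quotient.mk I (m * h) := by
        rw [hfg, hq, map_smul, ← hh, smul_eq_mul, map_mul]
      have hhk : vertexCharacter K k h = 1 := by rw [← quotientCharacter_mk hI, hh, hp]
      rw [map_smul, GruenbergModule.coeff_smul_eq_of_toKer_eq hI hγ hr hm hhk hgq]

theorem exists_apply_ne_zero_of_isStableSyzygy (hI : IsAdmissible I) {i k : V}
    {γ : Quiver.Path i k} (hγ : γ.length = 2) {ρ : PathAlgebra K V} (hρ : ρ ∈ I)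
    (hργ : coeffHom K γ ρ ≠ 0) {s : PathAlgebra K V ⧸ I}
    (hs : ∀ u, s * u = quotientCharacter hI i u • s) {S L N : Type x} [AddCommGroup S]
    [Module (PathAlgebra K V ⧸ I) S] [AddCommGroup L] [Module (PathAlgebra K V ⧸ I) L]
    [AddCommGroup N] [Module (PathAlgebra K V ⧸ I) N]
    (e : S ≃ₗ[PathAlgebra K V ⧸ I] OneDim (quotientCharacter hI k))
    (hSL : IsStableSyzygy (PathAlgebra K V ⧸ I) S L)
    (hLN : IsStableSyzygy (PathAlgebra K V ⧸ I) L N) :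
    ∃ (Θ : N →ₗ[PathAlgebra K V ⧸ I] OneDim (quotientCharacter hI i)) (z : N),
      s • z = 0 ∧ Θ z ≠ 0 := by
  obtain ⟨P, _, _, j, π, _, hj, hjπ, hπ⟩ := hSL
  obtain ⟨Q, _, _, ι, σ, _, hι, hισ, hσ⟩ := hLN
  obtain ⟨f, hf⟩ := Module.projective_lifting_property (OneDim.proj (quotientCharacter hI k))
    (e.toLinearMap ∘ₗ π) OneDim.proj_surjective
  have hχf (p : P) : quotientCharacter hI k (f p) = e (π p) := LinearMap.congr_fun hf p
  have hker (q : Q) : (f ∘ₗ j ∘ₗ σ) q ∈ RingHom.ker (quotientCharacter hI k) :=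
    (hχf _).trans (by rw [LinearMap.comp_apply, hjπ.apply_apply_eq_zero, map_zero]; rfl)
  obtain ⟨g, hg⟩ := Module.projective_lifting_property (GruenbergModule.toKer hI k)
    ((f ∘ₗ j ∘ₗ σ).codRestrict (RingHom.ker (quotientCharacter hI k)) hker)
    (GruenbergModule.toKer_surjective hI k)
  obtain ⟨p, hp⟩ := (e.surjective.comp hπ) (1 : K)
  have hd (u : PathAlgebra K V ⧸ I) (hu : quotientCharacter hI k u = 0) :
      ∃ q, (j ∘ₗ σ) q = u • p := by
    obtain ⟨l, hl⟩ := (hjπ (u • p)).1 (e.injective (by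
      rw [map_smul, map_smul, OneDim.smul_eq, hu, zero_smul, map_zero]))
    obtain ⟨q, rfl⟩ := hσ l
    exact ⟨q, hl⟩
  obtain ⟨q, hq, hsq, hcq⟩ := exists_smul_eq_zero_of_mem_arrowIdeal_sq hI hγ hs
    (fun q => congrArg Subtype.val (LinearMap.congr_fun hg q)) ((hχf p).trans hp) hd (hI.2.1 hρ)
  rw [Ideal.Quotient.eq_zero_iff_mem.2 hρ, zero_smul] at hq
  obtain ⟨z, rfl⟩ := (hισ q).1 (hj (hq.trans (map_zero j).symm))
  have hgι (z : N) : (g ∘ₗ ι) z ∈ LinearMap.ker (GruenbergModule.toKer hI k) := by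
    refine (LinearMap.congr_fun hg (ι z)).trans (Subtype.ext ?_)
    exact (congrArg (f ∘ₗ j) (hισ.apply_apply_eq_zero z)).trans (map_zero _)
  refine ⟨GruenbergModule.kerCoeff hI hγ ∘ₗ (g ∘ₗ ι).codRestrict _ hgι, z,
    hι (by rw [map_smul, hsq, map_zero]), fun h => hργ (hcq.symm.trans h)⟩

theorem nonempty_hom_of_isStableSyzygy (hI : IsAdmissible I) {i k : V} {γ : Quiver.Path i k}
    (hγ : γ.length = 2) {ρ : PathAlgebra K V} (hρ : ρ ∈ I) (hργ : coeffHom K γ ρ ≠ 0)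
    {s : PathAlgebra K V ⧸ I} (hs : IsSocleGenerator (quotientCharacter hI i) s)
    {S L₁ L₂ L₃ S' : Type x} [AddCommGroup S] [Module (PathAlgebra K V ⧸ I) S] [AddCommGroup L₁]
    [Module (PathAlgebra K V ⧸ I) L₁] [AddCommGroup L₂] [Module (PathAlgebra K V ⧸ I) L₂]
    [AddCommGroup L₃] [Module (PathAlgebra K V ⧸ I) L₃] [AddCommGroup S']
    [Module (PathAlgebra K V ⧸ I) S']
    (e : S ≃ₗ[PathAlgebra K V ⧸ I] OneDim (quotientCharacter hI k))
    (h₁ : IsStableSyzygy (PathAlgebra K V ⧸ I) S L₁)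
    (h₂ : IsStableSyzygy (PathAlgebra K V ⧸ I) L₁ L₂)
    (h₃ : IsStableSyzygy (PathAlgebra K V ⧸ I) L₂ L₃)
    (h₄ : IsStableSyzygy (PathAlgebra K V ⧸ I) L₃ S')
    (e' : S' ≃ₗ[PathAlgebra K V ⧸ I] OneDim (quotientCharacter hI k)) : Nonempty (k ⟶ i) := by
  by_contra h
  rw [not_nonempty_iff] at h
  obtain ⟨Θ, z, hsz, hΘ⟩ := exists_apply_ne_zero_of_isStableSyzygy hI hγ hρ hργ hs.mul_right e h₁ h₂
  exact hΘ (hs.apply_eq_zero_of_isStableSyzygy h₃ h₄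
    ((extVanishes_quotientCharacter hI).congr e') Θ hsz)

end Quotient

end PathAlgebra

end

theorem proposition4p1_general {K : Type u} [Field K] {V : Type v} [Quiver.{w} V] [Fintype V]
    [∀ a b : V, Finite (a ⟶ b)] {I : Ideal (PathAlgebra K V)} [I.IsTwoSided]
    (hI : PathAlgebra.IsAdmissible I) (hsymm : IsSymmetricFDAlgebra K (PathAlgebra K V ⧸ I))
    (hper : letI : Module (Enveloping K (PathAlgebra K V ⧸ I)) (PathAlgebra K V ⧸ I) :=
        TensorProduct.Algebra.module
      IsIteratedSyzygy (Enveloping K (PathAlgebra K V ⧸ I)) 4 (PathAlgebra K V ⧸ I)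
        (PathAlgebra K V ⧸ I))
    {i j k : V} {α : i ⟶ j} {β : j ⟶ k} {ρ : PathAlgebra K V} (hρ : ρ ∈ I)
    (hαβ : ρ.coeff (α.toPath.comp β.toPath) ≠ 0) : Nonempty (k ⟶ i) := by
  let : Module (Enveloping K (PathAlgebra K V ⧸ I)) (PathAlgebra K V ⧸ I) :=
    TensorProduct.Algebra.module
  obtain ⟨L₁, _, _, h₁, L₂, _, _, h₂, L₃, _, _, h₃, L₄, _, _, h₄, ⟨e⟩⟩ := hper
  have hΛ₁ := h₁.isStableSyzygy
  have h₁₂ := h₂.isStableSyzygy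
  have h₂₃ := h₃.isStableSyzygy
  have h₃Λ := h₄.isStableSyzygy.congr_right e.symm
  have := hΛ₁.projective_rightModule
  have := h₁₂.projective_rightModule
  have := h₂₃.projective_rightModule
  have := hI.finiteDimensional
  obtain ⟨s, hs⟩ := hsymm.exists_isSocleGenerator (PathAlgebra.quotientCharacter hI i)
  let χ := PathAlgebra.quotientCharacter hI k
  exact PathAlgebra.nonempty_hom_of_isStableSyzygy hI rfl hρ hαβ hs (Coinvariants.regularEquiv χ)
    (hΛ₁.coinvariants χ) (h₁₂.coinvariants χ) (h₂₃.coinvariants χ) (h₃Λ.coinvariants χ)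
    (Coinvariants.regularEquiv χ)

theorem proposition4p1 {K : Type u} [Field K] [IsAlgClosed K]
    {V : Type v} [Quiver.{w} V] [Fintype V] [∀ a b : V, Finite (a ⟶ b)]
    (hQ : IsConnectedQuiver V)
    (I : Ideal (PathAlgebra K V)) [I.IsTwoSided] (hI : PathAlgebra.IsAdmissible I)
    (hsymm : IsSymmetricFDAlgebra K (PathAlgebra K V ⧸ I))
    (hper : IsPeriodicAlgebra K (PathAlgebra K V ⧸ I) 4)
    {i j k : V} (α : i ⟶ j) (β : j ⟶ k)
    (hαβ : PathAlgebra.OccursInMinimalRelation I (α.toPath.comp β.toPath)) :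
    Nonempty (k ⟶ i) := by
  obtain ⟨ρ, ⟨hρ, -⟩, hαβ⟩ := hαβ
  exact proposition4p1_general hI hsymm hper.2.1 hρ hαβ
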